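/- Consider the downlink of a cellular network with $G$ cells, one base station (BS) with $N$ antennas per cell, $K_g \ge 0$ users in cell $g$ (at least one user in total), each user having $M$ antennas and being served one data stream. Let $H_{(i,gk)} \in \mathbb{C}^{M\times N}$ be the channel matrix from BS $i$ to the $k$-th user of cell $g$, and let $\mathcal I \subseteq \{(i,gk) : 1\le i,g\le G,\ g\ne i,\ 1\le k\le K_g\}$ be a set of BS–user pairs. Beamformers that null the interference prescribed by $\mathcal I$ are nonzero receive vectors $u_{gk}\in\mathbb{C}^M$ and transmit vectors $v_{gk}\in\mathbb{C}^N$, one of each for every user, such that $v_{g1},\dots,v_{gK_g}$ are linearly independent for every $g$ and $$u_{gk}^H H_{(i,gk)} v_{ij} = 0 \qquad \text{for all } (i,gk)\in\mathcal I \text{ and all } j\in\{1,\dots,K_i\}.$$ For $\mathcal J\subseteq \mathcal I$ let $\mathcal J_{users}$ and $\mathcal J_{BS}$ be the sets of user indices $gk$ and of BS indices $i$ that appear in $\mathcal J$. Then, for generic channels (that is, for all channel coefficients in some non-empty Zariski open subset of the space of all channel coefficients over $\mathbb{C}$), such beamformers exist if and only if $M\ge 1$, $N\ge K_g$ for every $g$,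 and $$|\mathcal J_{users}|\,(M-1)+\sum_{l\in\mathcal J_{BS}}(N-K_l)K_l\ \ge\ \sum_{(l,gk)\in\mathcal J}K_l \qquad\text{for every } \mathcal J\subseteq\mathcal I.$$ In particular, if every cell has the same number $K$ of users, then for generic channels such beamformers exist if and only if $M\ge1$, $N\ge K$, and $$|\mathcal J_{users}|\,(M-1)+|\mathcal J_{BS}|\,(N-K)K\ \ge\ |\mathcal J|\,K \qquad\text{for every } \mathcal J\subseteq\mathcal I.$$ -/

import Mathlib

namespace CellularIA

/-- A subset of affine space `ℂ^σ` is Zariski open if it is the complement of the common zero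
locus of a set `S` of polynomials. -/
def IsZariskiOpen {σ : Type} (U : Set (σ → ℂ)) : Prop :=
  ∃ S : Set (MvPolynomial σ ℂ), U = {x | ∀ p ∈ S, MvPolynomial.eval x p = 0}ᶜ

/-- A property of points of `ℂ^σ` holds generically if it holds on a non-empty Zariski open set. -/
def Generically {σ : Type} (P : (σ → ℂ) → Prop) : Prop :=
  ∃ U : Set (σ → ℂ), IsZariskiOpen U ∧ U.Nonempty ∧ ∀ x ∈ U, P x

/-- The users of a network with `G` cells and `K g` users in cell `g`: the double indices `gk`. -/
abbrev User {G : ℕ} (K : Fin G → ℕ) : Type := Σ g : Fin G, Fin (K g)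

/-- BS-user pairs `(i, gk)`. -/
abbrev BSUser {G : ℕ} (K : Fin G → ℕ) : Type := Fin G × User K

/-- Index set of all channel coefficients: one `M × N` matrix for every BS-user pair. -/
abbrev Coeff {G : ℕ} (K : Fin G → ℕ) (M N : ℕ) : Type := BSUser K × Fin M × Fin N

/-- The `M × N` channel matrix `H_(i,gk)` from BS `i` to user `gk`, read off from the vector of
all channel coefficients. -/
def channel {G : ℕ} {K : Fin G → ℕ} {M N : ℕ} (h : Coeff K M N → ℂ) (p : BSUser K) :
    Matrix (Fin M) (Fin N) ℂ :=
  Matrix.of fun a b => h (p, a, b)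

/-- For the channel coefficients `h` there are receive beamformers `u_gk ∈ ℂ^M` (nonzero) and
transmit beamformers `v_gk ∈ ℂ^N` (linearly independent within each cell) such that, for every
pair `(i, gk) ∈ I`, the interference of BS `i` at user `gk` is completely nulled:
`u_gkᴴ H_(i,gk) v_ij = 0` for all users `j` of cell `i`. -/
def Feasible {G : ℕ} {K : Fin G → ℕ} {M N : ℕ} (I : Finset (BSUser K))
    (h : Coeff K M N → ℂ) : Prop :=
  ∃ (u : User K → Fin M → ℂ) (v : User K → Fin N → ℂ),
    (∀ gk, u gk ≠ 0) ∧
    (∀ g : Fin G, LinearIndependent ℂ (fun k : Fin (K g) => v ⟨g, k⟩)) ∧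
    ∀ p ∈ I, ∀ j : Fin (K p.1),
      dotProduct (star (u p.2)) ((channel h p).mulVec (v ⟨p.1, j⟩)) = 0

/-- The BS indices that appear in `J`. -/
def bsOf {G : ℕ} {K : Fin G → ℕ} (J : Finset (BSUser K)) : Finset (Fin G) := J.image Prod.fst

/-- The user indices that appear in `J`. -/
def usersOf {G : ℕ} {K : Fin G → ℕ} (J : Finset (BSUser K)) : Finset (User K) :=
  J.image Prod.snd

end CellularIA

/-! A nonzero receive vector can be scaled to have an entry 1, and the independent transmit vectors
of a cell can be recombined so that suitable columns form an identity matrix. Finitely many such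
charts `(a, s)` cover all beamformers. In a chart every scalar equation contains a channel
coefficient of its own, its pivot, with factor 1, and can be solved for it. So the feasible channels
are covered by the images of the polynomial maps `chartPoly`, whose parameters are the other
coefficients and the free beamformer coordinates.

Necessity is a dimension count: if `J` violates its inequality, a chart for `J` has fewer parameters
than there are coefficients (`card_chartVar`). Its image then satisfies an algebraic relation, and
no channel is feasible where the product of these relations is nonzero.

Sufficiency: if the gradients of `chartPoly` are independent at one point, the map is dominant
(Jacobian criterion) and its image contains a nonempty open set (Chevalley). At coordinate-vector
beamformers this concerns only the linear parts of the equations. The inequalities are Hall's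
condition for sets of equations closed under permuting the streams of a cell; submodularity extends
it to all sets, which gives a matching of equations to free coordinates. The streams of one pair
share entries, so a matching alone does not make the gradients independent; an explicit channel of
unit and Vandermonde type does. -/

namespace CellularIA

/-! ### Algebraic independence and dominant polynomial maps. -/

open MvPolynomial

/-- A matrix over a field with linearly independent rows has a nonzero maximal minor. -/
theorem exists_submatrix_det_ne_zero {F m n : Type*} [Field F] [Fintype m] [DecidableEq m]
    [Fintype n] (A : Matrix m n F) (hA : LinearIndependent F A.row) :
    ∃ s : m → n, Function.Injective s ∧ (A.submatrix id s).det ≠ 0 := by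
  classical
  obtain ⟨κ, a, ha, hspan, hli⟩ := exists_linearIndependent' F A.col
  have : Fintype κ := Fintype.ofInjective a ha
  have hcard : Fintype.card κ = Fintype.card m := by
    rw [← finrank_span_eq_card hli, hspan, ← Matrix.rank_eq_finrank_span_cols,
      hA.rank_matrix]
  let e : m ≃ κ := (Fintype.equivOfCardEq hcard).symm
  refine ⟨a ∘ e, ha.comp e.injective, ?_⟩
  have h : LinearIndependent F (A.submatrix id (a ∘ e)).col := hli.comp e e.injective
  rw [Matrix.linearIndependent_cols_iff_isUnit, Matrix.isUnit_iff_isUnit_det] at h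
  exact h.ne_zero

theorem totalDegree_pderiv_le {R ι : Type*} [CommSemiring R] {p : MvPolynomial ι R} {n : ℕ}
    (hp : p.totalDegree ≤ n + 1) (i : ι) : (pderiv i p).totalDegree ≤ n := by
  refine Finset.sup_le fun m hm => ?_
  rw [mem_support_iff, coeff_pderiv] at hm
  have h := (le_totalDegree (mem_support_iff.2 (left_ne_zero_of_mul hm))).trans hp
  rw [Finsupp.sum_add_index' (fun _ => rfl) (fun _ _ _ => rfl), Finsupp.sum_single_index rfl] at h
  omega

theorem eq_C_of_pderiv_eq_zero {F ι : Type*} [Field F] [CharZero F] {p : MvPolynomial ι F}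
    (hp : ∀ i, pderiv i p = 0) : p = C (coeff 0 p) := by
  classical
  ext m
  rw [coeff_C]
  split_ifs with h
  · rw [h]
  · obtain ⟨i, hi⟩ : ∃ i, m i ≠ 0 := by
      by_contra! H
      exact h (Finsupp.ext fun i => (H i).symm)
    have h1 := congrArg (coeff (m - Finsupp.single i 1)) (hp i)
    rw [coeff_pderiv, tsub_add_cancel_of_le (by simpa [Nat.one_le_iff_ne_zero] using hi),
      coeff_zero] at h1
    exact (mul_eq_zero.1 h1).resolve_right (Nat.cast_add_one_ne_zero _)

/-- The chain rule for the composition of a polynomial with a family of polynomials. -/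
theorem pderiv_aeval_eq_sum {R ι τ : Type*} [CommRing R] [Fintype ι]
    (φ : ι → MvPolynomial τ R) (t : τ) (p : MvPolynomial ι R) :
    pderiv t (aeval φ p) = ∑ i, aeval φ (pderiv i p) * pderiv t (φ i) := by
  classical
  induction p using MvPolynomial.induction_on with
  | C a => simp [algebraMap_eq]
  | add p q hp hq => simp only [map_add, hp, hq, add_mul, Finset.sum_add_distrib]
  | mul_X p k h =>
    simp only [map_mul, aeval_X, Derivation.leibniz, smul_eq_mul, h, map_add, pderiv_X, add_mul,
      Finset.sum_add_distrib, Finset.mul_sum]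
    congr 1
    · rw [Finset.sum_eq_single k]
      · simp
      · intro b _ hb
        simp [hb.symm]
      · simp
    · exact Finset.sum_congr rfl fun i _ => by ring

/-- The Jacobian criterion: polynomials whose gradients are linearly independent at some point are
algebraically independent. -/
theorem algebraicIndependent_of_linearIndependent_pderiv {F ι τ : Type*} [Field F] [CharZero F]
    [Fintype ι] [Fintype τ] (φ : ι → MvPolynomial τ F) (x : τ → F)
    (h : LinearIndependent F fun i t => eval x (pderiv t (φ i))) :
    AlgebraicIndependent F φ := by
  classical
  obtain ⟨s, -, hs⟩ := exists_submatrix_det_ne_zero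
    (Matrix.of fun i t => eval x (pderiv t (φ i))) h
  let D : Matrix ι ι (MvPolynomial τ F) := Matrix.of fun i k => pderiv (s k) (φ i)
  have hD : D.det ≠ 0 := by
    intro h0
    apply hs
    have := congrArg (eval x) h0
    rw [RingHom.map_det, map_zero] at this
    exact this
  rw [algebraicIndependent_iff]
  -- Induction on the degree of a relation `p`: by the chain rule the partial derivatives of `p` at
  -- `φ` form a row vector killed by the nonsingular `D`. They are relations of smaller degree,
  -- hence zero, and `p` is constant.
  suffices ∀ (n : ℕ) (p : MvPolynomial ι F), p.totalDegree ≤ n → aeval φ p = 0 → p = 0 from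
    fun p hp => this _ p le_rfl hp
  have hconst : ∀ p : MvPolynomial ι F, p = C (coeff 0 p) → aeval φ p = 0 → p = 0 := by
    intro p hp h0
    rw [hp, aeval_C, algebraMap_eq, C_eq_zero] at h0
    rw [hp, h0, C_0]
  intro n
  induction n with
  | zero => exact fun p hp => hconst p (totalDegree_eq_zero_iff_eq_C.1 (Nat.le_zero.1 hp))
  | succ n ih =>
    intro p hp h0
    refine hconst p (eq_C_of_pderiv_eq_zero fun i => ih _ (totalDegree_pderiv_le hp i) ?_) h0
    have hv : Matrix.vecMul (fun i => aeval φ (pderiv i p)) D = 0 := by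
      funext k
      have := pderiv_aeval_eq_sum φ (s k) p
      rw [h0, map_zero] at this
      exact this.symm
    exact congrFun (Matrix.eq_zero_of_vecMul_eq_zero hD hv) i

/-- More polynomials than variables satisfy a nontrivial algebraic relation. -/
theorem exists_aeval_eq_zero_of_card_lt {F ι τ : Type} [Field F] [Fintype ι] [Fintype τ]
    (φ : ι → MvPolynomial τ F) (h : Fintype.card τ < Fintype.card ι) :
    ∃ p : MvPolynomial ι F, p ≠ 0 ∧ aeval φ p = 0 := by
  by_contra! H
  have hφ : AlgebraicIndependent F φ :=
    (algebraicIndependent_iff).2 fun p hp => by_contra fun hp0 => H p hp0 hp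
  have := hφ.cardinalMk_le_trdeg
  rw [MvPolynomial.trdeg_of_isDomain] at this
  simp at this
  omega

/-- The image of a dominant polynomial map between affine spaces over an algebraically closed field
contains a nonempty principal open set. -/
theorem exists_forall_mem_image_of_algebraicIndependent {F ι τ : Type*} [Field F] [IsAlgClosed F]
    [Finite ι] [Finite τ] (φ : ι → MvPolynomial τ F) (hφ : AlgebraicIndependent F φ) :
    ∃ c : MvPolynomial ι F, c ≠ 0 ∧ ∀ y : ι → F, eval y c ≠ 0 →
      ∃ x : τ → F, ∀ i, eval x (φ i) = y i := by
  let f : MvPolynomial ι F →+* MvPolynomial τ F := (aeval φ : _ →ₐ[F] _).toRingHom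
  have hf : Function.Injective f := hφ
  have hfp : f.FinitePresentation := by
    refine RingHom.FinitePresentation.of_finiteType.1
      (RingHom.FiniteType.of_comp_finiteType (f := C) (g := f) ?_)
    have : f.comp C = algebraMap F (MvPolynomial τ F) := by
      ext a
      simp [f, algebraMap_eq]
    rw [this]
    exact RingHom.finiteType_algebraMap.2 inferInstance
  -- By Chevalley the range on spectra is constructible. By injectivity it contains the generic
  -- point, so the piece containing that point has only zero closed conditions and is a basic open
  -- set.
  obtain ⟨S, hS⟩ := PrimeSpectrum.exists_constructibleSetData_iff.2
    (PrimeSpectrum.isConstructible_range_comap hfp)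
  have hbot : (⊥ : PrimeSpectrum (MvPolynomial ι F)) ∈ S.toSet := by
    rw [hS]
    refine ⟨⊥, ?_⟩
    ext1
    exact (RingHom.injective_iff_ker_eq_bot f).1 hf
  simp only [PrimeSpectrum.ConstructibleSetData.toSet, Set.mem_iUnion] at hbot
  obtain ⟨B, hB, hbot⟩ := hbot
  refine ⟨B.f, ?_, fun y hy => ?_⟩
  · intro h0
    apply hbot.2
    simp [h0]
  have hg : ∀ k, B.g k = 0 := fun k => by
    have := hbot.1 (Set.mem_range_self k)
    simpa using this
  let P : PrimeSpectrum (MvPolynomial ι F) := ⟨vanishingIdeal F {y}, inferInstance⟩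
  have hP : P ∈ S.toSet := by
    simp only [PrimeSpectrum.ConstructibleSetData.toSet, Set.mem_iUnion]
    refine ⟨B, hB, ?_, ?_⟩
    · rintro _ ⟨k, rfl⟩
      rw [hg]
      exact zero_mem _
    · intro h
      have := h rfl
      apply hy
      simpa [P] using this
  rw [hS] at hP
  obtain ⟨Q, hQ⟩ := hP
  -- `Q` need not be a closed point; a larger maximal ideal still contains the images of the `X i -
  -- C (y i)`, and the Nullstellensatz makes it a point `x`.
  obtain ⟨m, hm, hQm⟩ := Q.asIdeal.exists_le_maximal Q.isPrime.ne_top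
  obtain ⟨x, rfl⟩ := eq_vanishingIdeal_singleton_of_isMaximal F hm
  refine ⟨x, fun i => ?_⟩
  have h1 : (X i - C (y i) : MvPolynomial ι F) ∈ P.asIdeal := by simp [P]
  rw [← hQ] at h1
  have h2 := hQm h1
  simp [f, algebraMap_eq, sub_eq_zero] at h2
  exact h2

end CellularIA

/-! ### Hall's condition and the matching of equations to free coordinates. -/

namespace CellularIA

/-- Hall's condition need only be checked on the sets that are invariant under a family of
symmetries of the bipartite graph. -/
theorem card_le_card_biUnion_of_invariant {α β Γ : Type*} [Fintype α] [DecidableEq α]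
    [DecidableEq β] (N : α → Finset β) (σ : Γ → Equiv.Perm α) (τ : Γ → Equiv.Perm β)
    (hN : ∀ g x, N (σ g x) = (N x).image (τ g))
    (h : ∀ R : Finset α, (∀ g, ∀ x ∈ R, σ g x ∈ R) → R.card ≤ (R.biUnion N).card)
    (R : Finset α) : R.card ≤ (R.biUnion N).card := by
  -- `f` is submodular, so its minimisers are closed under union. A minimiser of largest cardinality
  -- absorbs its translates by the symmetries and is therefore invariant.
  let f : Finset α → ℤ := fun R => ((R.biUnion N).card : ℤ) - R.card
  obtain ⟨R₀, -, hR₀⟩ := Finset.exists_min_image (Finset.univ : Finset (Finset α)) f ⟨∅, by simp⟩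
  obtain ⟨R₁, hR₁, hmax⟩ := Finset.exists_max_image
    (Finset.univ.filter fun S => f S = f R₀) Finset.card ⟨R₀, by simp⟩
  have hf₁ : f R₁ = f R₀ := (Finset.mem_filter.1 hR₁).2
  have hinv : ∀ g, ∀ x ∈ R₁, σ g x ∈ R₁ := by
    intro g x hx
    set S := R₁.image (σ g) with hS
    have hSN : S.biUnion N = (R₁.biUnion N).image (τ g) := by
      ext b
      simp only [hS, Finset.mem_biUnion, Finset.mem_image, exists_exists_and_eq_and, hN]
      aesop
    have hcS : S.card = R₁.card := Finset.card_image_of_injective _ (σ g).injective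
    have hcN : (S.biUnion N).card = (R₁.biUnion N).card := by
      rw [hSN, Finset.card_image_of_injective _ (τ g).injective]
    have h1 := Finset.card_union_add_card_inter R₁ S
    have h2 := Finset.card_union_add_card_inter (R₁.biUnion N) (S.biUnion N)
    rw [← Finset.union_biUnion] at h2
    have h3 : ((R₁ ∩ S).biUnion N).card ≤ (R₁.biUnion N ∩ S.biUnion N).card :=
      Finset.card_le_card (Finset.subset_inter
        (Finset.biUnion_subset_biUnion_of_subset_left _ Finset.inter_subset_left)
        (Finset.biUnion_subset_biUnion_of_subset_left _ Finset.inter_subset_right))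
    have h4 : f R₀ ≤ f (R₁ ∩ S) := hR₀ _ (Finset.mem_univ _)
    have h5 : f R₀ ≤ f (R₁ ∪ S) := hR₀ _ (Finset.mem_univ _)
    have h6 : f (R₁ ∪ S) = f R₀ := by
      simp only [f] at *
      omega
    have h7 := hmax (R₁ ∪ S) (by simp [h6])
    have h8 : R₁ = R₁ ∪ S := Finset.eq_of_subset_of_card_le Finset.subset_union_left h7
    rw [h8]
    exact Finset.mem_union_right _ (Finset.mem_image_of_mem _ hx)
  have h1 := h R₁ hinv
  have h2 := hR₀ R (Finset.mem_univ _)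
  simp only [f] at *
  omega

/-- A combination of the values at distinct nodes that kills enough powers is trivial. -/
theorem eq_zero_of_forall_sum_mul_pow_eq_zero {F ι : Type*} [Field F] [DecidableEq ι]
    (S : Finset ι) (z g : ι → F) (hz : Set.InjOn z S)
    (h : ∀ k < S.card, ∑ i ∈ S, g i * z i ^ k = 0) : ∀ i ∈ S, g i = 0 := by
  intro i hi
  -- By linearity the hypothesis extends from powers to all polynomials of degree below `S.card`;
  -- the Lagrange basis polynomial at `i` then isolates `g i`.
  have hp : ∀ p : Polynomial F, p.natDegree < S.card → ∑ i ∈ S, g i * p.eval (z i) = 0 := by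
    intro p hp
    simp only [Polynomial.eval_eq_sum_range, Finset.mul_sum]
    rw [Finset.sum_comm]
    refine Finset.sum_eq_zero fun k hk => ?_
    have := h k (by rw [Finset.mem_range] at hk; omega)
    calc ∑ x ∈ S, g x * (p.coeff k * z x ^ k) = p.coeff k * ∑ x ∈ S, g x * z x ^ k := by
          rw [Finset.mul_sum]
          exact Finset.sum_congr rfl fun _ _ => by ring
      _ = 0 := by rw [this, mul_zero]
  have hpos : 0 < S.card := Finset.card_pos.2 ⟨i, hi⟩
  have h1 := hp (Lagrange.basis S z i) (by
    rw [Polynomial.natDegree_eq_of_degree_eq_some (Lagrange.degree_basis hz hi)]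
    omega)
  rw [Finset.sum_eq_single i, Lagrange.eval_basis_self hz hi, mul_one] at h1
  · exact h1
  · intro b hb hbi
    rw [Lagrange.eval_basis_of_ne hbi.symm hb, mul_zero]
  · exact fun h => absurd hi h

variable {G M N : ℕ} {K : Fin G → ℕ}

/-- The receive coordinates of the users in `A` that are not normalised by the chart `a`. -/
def freeRx (a : User K → Fin M) (A : Finset (User K)) : Finset (User K × Fin M) :=
  Finset.univ.filter fun x => x.1 ∈ A ∧ x.2 ≠ a x.1

/-- The transmit coordinates of the cells in `B` that are not normalised by the chart `s`. -/
def freeTx (s : ∀ i, Fin (K i) → Fin N) (B : Finset (Fin G)) : Finset (User K × Fin N) :=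
  Finset.univ.filter fun y => y.1.1 ∈ B ∧ ∀ j, s y.1.1 j ≠ y.2

theorem mem_freeRx {a : User K → Fin M} {A : Finset (User K)} {x : User K × Fin M} :
    x ∈ freeRx a A ↔ x.1 ∈ A ∧ x.2 ≠ a x.1 := by
  simp [freeRx]

theorem mem_freeTx {s : ∀ i, Fin (K i) → Fin N} {B : Finset (Fin G)} {y : User K × Fin N} :
    y ∈ freeTx s B ↔ y.1.1 ∈ B ∧ ∀ j, s y.1.1 j ≠ y.2 := by
  simp [freeTx]

theorem card_freeRx (a : User K → Fin M) (A : Finset (User K)) :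
    ((freeRx a A).card : ℤ) = A.card * ((M : ℤ) - 1) := by
  have h : ∀ u, ((Finset.univ.filter fun b : Fin M => b ≠ a u).card : ℤ) = (M : ℤ) - 1 := by
    intro u
    rw [Finset.filter_ne', Finset.card_erase_of_mem (Finset.mem_univ _), Finset.card_univ,
      Fintype.card_fin]
    have := (a u).pos
    omega
  have h1 : (freeRx a A).card = ∑ u ∈ A, (Finset.univ.filter fun b : Fin M => b ≠ a u).card := by
    rw [Finset.card_eq_sum_card_fiberwise (f := Prod.fst) (t := A)
      (fun x hx => (mem_freeRx.1 hx).1)]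
    refine Finset.sum_congr rfl fun u hu => ?_
    refine Finset.card_nbij' Prod.snd (fun b => (u, b)) ?_ ?_ ?_ ?_ <;>
      simp +contextual [Set.MapsTo, Set.LeftInvOn, mem_freeRx, hu]
    aesop
  rw [h1]
  push_cast
  rw [Finset.sum_congr rfl fun u _ => h u, Finset.sum_const, nsmul_eq_mul]

theorem card_unused {n : ℕ} (f : Fin n → Fin N) (hf : Function.Injective f) :
    ((Finset.univ.filter fun b : Fin N => ∀ j, f j ≠ b).card : ℤ) = (N : ℤ) - n := by
  have h : (Finset.univ.filter fun b : Fin N => ∀ j, f j ≠ b) = (Finset.univ.image f)ᶜ := by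
    ext
    simp
  have hle := Fintype.card_le_of_injective f hf
  rw [h, Finset.card_compl, Finset.card_image_of_injective _ hf]
  simp at hle ⊢
  omega

theorem card_freeTx (s : ∀ i, Fin (K i) → Fin N) (hs : ∀ i, Function.Injective (s i))
    (B : Finset (Fin G)) :
    ((freeTx s B).card : ℤ) = ∑ l ∈ B, ((N : ℤ) - K l) * K l := by
  have h1 : (freeTx s B).card =
      ∑ u ∈ B.sigma fun i => (Finset.univ : Finset (Fin (K i))),
      (Finset.univ.filter fun b : Fin N => ∀ j, s u.1 j ≠ b).card := by
    rw [Finset.card_eq_sum_card_fiberwise (f := Prod.fst)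
      (t := B.sigma fun i => (Finset.univ : Finset (Fin (K i)))) (fun x hx => by
        simpa using (mem_freeTx.1 hx).1)]
    refine Finset.sum_congr rfl fun u hu => ?_
    have hu' : u.1 ∈ B := by simpa using hu
    refine Finset.card_nbij' Prod.snd (fun b => (u, b)) ?_ ?_ ?_ ?_ <;>
      simp +contextual [Set.MapsTo, Set.LeftInvOn, mem_freeTx, hu']
    aesop
  rw [h1, Finset.sum_sigma]
  push_cast
  refine Finset.sum_congr rfl fun l _ => ?_
  rw [Finset.sum_const, nsmul_eq_mul, card_unused (s l) (hs l), Finset.card_univ,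
    Fintype.card_fin, mul_comm]

/-- The scalar equations of the interference pairs in `J`. -/
abbrev Row (J : Finset (BSUser K)) : Type := Σ p : {p // p ∈ J}, Fin (K p.1.1)

theorem card_row (J : Finset (BSUser K)) : Fintype.card (Row J) = ∑ p ∈ J, K p.1 := by
  rw [Fintype.card_sigma, ← Finset.sum_coe_sort J]
  simp

/-- The variables in the linear part of an equation. -/
def rowVars (a : User K → Fin M) (s : ∀ i, Fin (K i) → Fin N) {J : Finset (BSUser K)}
    (r : Row J) : Finset ((User K × Fin M) ⊕ (User K × Fin N)) :=
  (Finset.univ.filter fun x => x.1 = r.1.1.2 ∧ x.2 ≠ a x.1).disjSum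
    (Finset.univ.filter fun y => y.1 = ⟨r.1.1.1, r.2⟩ ∧ ∀ j, s y.1.1 j ≠ y.2)

theorem inl_mem_rowVars {a : User K → Fin M} {s : ∀ i, Fin (K i) → Fin N} {J : Finset (BSUser K)}
    {r : Row J} {x} : Sum.inl x ∈ rowVars a s r ↔ x.1 = r.1.1.2 ∧ x.2 ≠ a x.1 := by
  simp [rowVars]

theorem inr_mem_rowVars {a : User K → Fin M} {s : ∀ i, Fin (K i) → Fin N} {J : Finset (BSUser K)}
    {r : Row J} {y} :
    Sum.inr y ∈ rowVars a s r ↔ y.1 = ⟨r.1.1.1, r.2⟩ ∧ ∀ j, s y.1.1 j ≠ y.2 := by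
  simp [rowVars]

/-- If every subsystem is proper, each equation can be assigned a variable of its own. -/
theorem exists_matching (a : User K → Fin M) (s : ∀ i, Fin (K i) → Fin N)
    (hs : ∀ i, Function.Injective (s i)) (I : Finset (BSUser K))
    (hI : ∀ J ⊆ I, ((usersOf J).card : ℤ) * ((M : ℤ) - 1)
      + ∑ l ∈ bsOf J, ((N : ℤ) - (K l : ℤ)) * (K l : ℤ) ≥ ∑ p ∈ J, (K p.1 : ℤ)) :
    ∃ m : Row I → (User K × Fin M) ⊕ (User K × Fin N),
      Function.Injective m ∧ ∀ r, m r ∈ rowVars a s r := by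
  rw [← Finset.all_card_le_biUnion_card_iff_exists_injective]
  -- The symmetries permute the streams within each cell; receive coordinates stay fixed.
  let σ : (∀ i, Equiv.Perm (Fin (K i))) → Equiv.Perm (Row I) := fun π =>
    Equiv.sigmaCongrRight fun p => π p.1.1
  let τ : (∀ i, Equiv.Perm (Fin (K i))) →
      Equiv.Perm ((User K × Fin M) ⊕ (User K × Fin N)) := fun π =>
    Equiv.sumCongr (Equiv.refl _) (Equiv.prodCongr (Equiv.sigmaCongrRight π) (Equiv.refl _))
  refine card_le_card_biUnion_of_invariant (rowVars a s) σ τ ?_ ?_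
  · intro π r
    ext t
    have himage : t ∈ (rowVars a s r).image (τ π) ↔ (τ π).symm t ∈ rowVars a s r := by
      rw [Finset.mem_image]
      exact ⟨fun ⟨b, hb, h⟩ => by rwa [← h, Equiv.symm_apply_apply],
        fun h => ⟨_, h, Equiv.apply_symm_apply _ _⟩⟩
    rw [himage]
    rcases t with x | ⟨⟨i, j⟩, b⟩
    · change _ ↔ Sum.inl x ∈ _
      rw [inl_mem_rowVars, inl_mem_rowVars]
      rfl
    · change _ ↔ Sum.inr ((⟨i, (π i).symm j⟩ : User K), b) ∈ _
      rw [inr_mem_rowVars, inr_mem_rowVars]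
      refine and_congr_left' ?_
      obtain ⟨⟨p, hp⟩, k⟩ := r
      change (⟨i, j⟩ : User K) = ⟨p.1, π p.1 k⟩ ↔ (⟨i, (π i).symm j⟩ : User K) = ⟨p.1, k⟩
      constructor
      · intro h
        obtain ⟨rfl, h⟩ := Sigma.mk.inj_iff.1 h
        rw [eq_of_heq h, Equiv.symm_apply_apply]
      · intro h
        obtain ⟨rfl, h⟩ := Sigma.mk.inj_iff.1 h
        rw [← eq_of_heq h, Equiv.apply_symm_apply]
  · intro R hR
    let J := R.image fun r => r.1.1
    have hJ : J ⊆ I := by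
      intro p hp
      obtain ⟨r, -, rfl⟩ := Finset.mem_image.1 hp
      exact r.1.2
    have hmem : ∀ r : Row I, r ∈ R ↔ r.1.1 ∈ J := by
      intro r
      refine ⟨fun h => Finset.mem_image_of_mem _ h, fun h => ?_⟩
      obtain ⟨⟨p, j⟩, hr', hp⟩ := Finset.mem_image.1 h
      obtain ⟨q, k⟩ := r
      obtain rfl : p = q := Subtype.ext hp
      -- Swapping streams `j` and `k` in this one cell carries one equation of the pair to the
      -- other, so an invariant `R` contains all equations of a pair or none.
      have := hR (fun i => if h : i = p.1.1 then Equiv.swap (h ▸ j) (h ▸ k) else Equiv.refl _)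
        _ hr'
      simpa [σ] using this
    have hcard : (R.card : ℤ) = ∑ p ∈ J, (K p.1 : ℤ) := by
      have : R.card = ∑ p ∈ J, K p.1 := by
        rw [Finset.card_eq_sum_card_image (fun r : Row I => r.1.1) R]
        refine Finset.sum_congr rfl fun p hp => ?_
        have : R.filter (fun r => r.1.1 = p) =
            Finset.univ.map ⟨fun j : Fin (K p.1) => (⟨⟨p, hJ hp⟩, j⟩ : Row I),
              fun _ _ h => by simpa using h⟩ := by
          ext ⟨q, j⟩
          simp only [Finset.mem_filter, hmem, Finset.mem_map, Finset.mem_univ, true_and]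
          constructor
          · rintro ⟨-, rfl⟩
            exact ⟨j, rfl⟩
          · rintro ⟨k, hk⟩
            obtain ⟨rfl, -⟩ := Sigma.mk.inj_iff.1 hk
            exact ⟨hp, rfl⟩
        rw [this, Finset.card_map, Finset.card_univ, Fintype.card_fin]
      exact_mod_cast this
    have hN : R.biUnion (rowVars a s) =
        (freeRx a (usersOf J)).disjSum (freeTx s (bsOf J)) := by
      ext t
      rcases t with x | ⟨⟨i, j⟩, b⟩
      · simp only [Finset.mem_biUnion, inl_mem_rowVars, Finset.inl_mem_disjSum, mem_freeRx,
          usersOf, Finset.mem_image]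
        constructor
        · rintro ⟨r, hr, h1, h2⟩
          exact ⟨⟨r.1.1, (hmem r).1 hr, h1.symm⟩, h2⟩
        · rintro ⟨⟨p, hp, h1⟩, h2⟩
          obtain ⟨r, hr, rfl⟩ := Finset.mem_image.1 hp
          exact ⟨r, hr, h1.symm, h2⟩
      · simp only [Finset.mem_biUnion, inr_mem_rowVars, Finset.inr_mem_disjSum, mem_freeTx,
          bsOf, Finset.mem_image]
        constructor
        · rintro ⟨r, hr, h1, h2⟩
          refine ⟨⟨r.1.1, (hmem r).1 hr, ?_⟩, h2⟩
          exact (congrArg Sigma.fst h1).symm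
        · rintro ⟨⟨p, hp, rfl⟩, h2⟩
          exact ⟨⟨⟨p, hJ hp⟩, j⟩, (hmem _).2 hp, rfl, h2⟩
    have := hI J hJ
    rw [hN, Finset.card_disjSum]
    zify
    rw [hcard, card_freeRx, card_freeTx s hs]
    exact this

end CellularIA

/-! ### Charts that parametrise the feasible channels. -/

namespace CellularIA

open MvPolynomial

variable {G M N : ℕ} {K : Fin G → ℕ}

/-- The channel coefficient that an equation is solved for in the chart `(a, s)`. -/
def pivot (a : User K → Fin M) (s : ∀ i, Fin (K i) → Fin N) {J : Finset (BSUser K)}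
    (r : Row J) : Coeff K M N :=
  (r.1.1, a r.1.1.2, s r.1.1.1 r.2)

theorem pivot_injective (a : User K → Fin M) {s : ∀ i, Fin (K i) → Fin N}
    (hs : ∀ i, Function.Injective (s i)) (J : Finset (BSUser K)) :
    Function.Injective (pivot a s : Row J → Coeff K M N) := by
  rintro ⟨⟨p, hp⟩, j⟩ ⟨⟨q, hq⟩, k⟩ h
  simp only [pivot, Prod.mk.injEq] at h
  obtain ⟨rfl, -, h⟩ := h
  rw [hs _ h]

theorem mem_usersOf {J : Finset (BSUser K)} (r : Row J) : r.1.1.2 ∈ usersOf J :=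
  Finset.mem_image.2 ⟨r.1.1, r.1.2, rfl⟩

theorem mem_bsOf {J : Finset (BSUser K)} (r : Row J) : r.1.1.1 ∈ bsOf J :=
  Finset.mem_image.2 ⟨r.1.1, r.1.2, rfl⟩

/-- The bilinear form `uᵀ H_p v`. -/
def pairing {R : Type*} [CommRing R] (H : Coeff K M N → R) (p : BSUser K) (u : Fin M → R)
    (v : Fin N → R) : R :=
  ∑ x : Fin M × Fin N, u x.1 * H (p, x.1, x.2) * v x.2

theorem dotProduct_channel_mulVec (h : Coeff K M N → ℂ) (p : BSUser K) (u : Fin M → ℂ)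
    (v : Fin N → ℂ) : dotProduct u ((channel h p).mulVec v) = pairing h p u v := by
  simp only [dotProduct, Matrix.mulVec, channel, Matrix.of_apply, pairing, Finset.mul_sum,
    Fintype.sum_prod_type, mul_assoc]

theorem map_pairing {R S : Type*} [CommRing R] [CommRing S] (f : R →+* S) (H : Coeff K M N → R)
    (p : BSUser K) (u : Fin M → R) (v : Fin N → R) :
    f (pairing H p u v) = pairing (fun c => f (H c)) p (fun b => f (u b)) (fun b => f (v b)) := by
  simp only [pairing, map_sum, map_mul]

/-- For normalised beamformers, an equation is solved by its pivot coefficient. -/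
theorem pairing_eq_add_pivot {R : Type*} [CommRing R] {a : User K → Fin M}
    {s : ∀ i, Fin (K i) → Fin N} {J : Finset (BSUser K)} {H H' : Coeff K M N → R}
    (hH : ∀ c, (∀ r : Row J, pivot a s r ≠ c) → H c = H' c)
    (hH' : ∀ r : Row J, H' (pivot a s r) = 0) (r : Row J) {u : Fin M → R} {v : Fin N → R}
    (hu : u (a r.1.1.2) = 1)
    (hv : ∀ j, v (s r.1.1.1 j) = if j = r.2 then 1 else 0) :
    pairing H r.1.1 u v = pairing H' r.1.1 u v + H (pivot a s r) := by
  rw [← sub_eq_iff_eq_add']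
  simp only [pairing, ← Finset.sum_sub_distrib]
  -- `H` and `H'` differ only at pivots. The pivots of this pair belong to its various streams, and
  -- `v` vanishes at the pivot columns of all streams but `r.2`.
  rw [Finset.sum_eq_single (a r.1.1.2, s r.1.1.1 r.2)]
  · have := hH' r
    simp only [pivot] at this
    simp [hu, hv, this, pivot]
  · rintro ⟨b, c⟩ - hbc
    by_cases h : ∀ q : Row J, pivot a s q ≠ (r.1.1, b, c)
    · simp [hH _ h]
    · push Not at h
      obtain ⟨⟨⟨q, hq⟩, k⟩, h⟩ := h
      simp only [pivot, Prod.mk.injEq] at h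
      obtain ⟨rfl, rfl, rfl⟩ := h
      have : k ≠ r.2 := fun h => hbc (by rw [h])
      simp [hv, this]
  · simp

/-- The parameters of a chart: the coefficients that are not pivots, and the coordinates of the
beamformers that are not normalised. -/
abbrev ChartVar (a : User K → Fin M) (s : ∀ i, Fin (K i) → Fin N) (J : Finset (BSUser K)) :
    Type :=
  {c : Coeff K M N // ∀ r : Row J, pivot a s r ≠ c} ⊕
    ({x // x ∈ freeRx a (usersOf J)} ⊕ {y // y ∈ freeTx s (bsOf J)})

section Chart

variable (a : User K → Fin M) (s : ∀ i, Fin (K i) → Fin N) (J : Finset (BSUser K))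

open Classical in
/-- The generic channel with the pivot coefficients set to zero. -/
noncomputable def chanPoly (c : Coeff K M N) : MvPolynomial (ChartVar a s J) ℂ :=
  if h : ∀ r : Row J, pivot a s r ≠ c then X (Sum.inl ⟨c, h⟩) else 0

/-- The generic normalised receive beamformers. -/
noncomputable def rxPoly (g : User K) (b : Fin M) : MvPolynomial (ChartVar a s J) ℂ :=
  if b = a g then 1
  else if h : (g, b) ∈ freeRx a (usersOf J) then X (Sum.inr (Sum.inl ⟨_, h⟩)) else 0

/-- The generic normalised transmit beamformers. -/
noncomputable def txPoly (y : User K) (b : Fin N) : MvPolynomial (ChartVar a s J) ℂ :=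
  if b = s y.1 y.2 then 1
  -- The final 0 serves two cases: pivot columns of the other streams, where normalisation forces
  -- it, and cells outside `bsOf J`, whose beamformers are irrelevant.
  else if h : (y, b) ∈ freeTx s (bsOf J) then X (Sum.inr (Sum.inr ⟨_, h⟩)) else 0

/-- The part of an equation that does not involve pivot coefficients. -/
noncomputable def eqPoly (r : Row J) : MvPolynomial (ChartVar a s J) ℂ :=
  pairing (chanPoly a s J) r.1.1 (rxPoly a s J r.1.1.2) (txPoly a s J ⟨r.1.1.1, r.2⟩)

/-- The channel coefficients as polynomials in the parameters of the chart. -/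
noncomputable def chartPoly (c : Coeff K M N) : MvPolynomial (ChartVar a s J) ℂ :=
  -- For injective `s i` distinct equations have distinct pivots, so at most one summand survives.
  chanPoly a s J c - ∑ r : Row J, if pivot a s r = c then eqPoly a s J r else 0

variable {a s J}

theorem chanPoly_pivot (r : Row J) : chanPoly a s J (pivot a s r) = 0 :=
  dif_neg fun h => h r rfl

theorem chartPoly_of_forall_ne {c : Coeff K M N} (h : ∀ r : Row J, pivot a s r ≠ c) :
    chartPoly a s J c = chanPoly a s J c := by
  simp [chartPoly, h]

theorem chartPoly_pivot (hs : ∀ i, Function.Injective (s i)) (r : Row J) :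
    chartPoly a s J (pivot a s r) = -eqPoly a s J r := by
  simp [chartPoly, chanPoly_pivot, (pivot_injective a hs J).eq_iff]

theorem txPoly_apply (hs : ∀ i, Function.Injective (s i)) (i : Fin G) (j k : Fin (K i)) :
    txPoly a s J ⟨i, j⟩ (s i k) = if k = j then 1 else 0 := by
  simp only [txPoly, (hs i).eq_iff]
  refine if_congr Iff.rfl rfl (dif_neg fun h => ?_)
  exact (mem_freeTx.1 h).2 k rfl

/-- Every channel parametrised by a chart of all prescribed interference is feasible. -/
theorem feasible_of_eval_chartPoly (hs : ∀ i, Function.Injective (s i))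
    {h : Coeff K M N → ℂ} (x : ChartVar a s J → ℂ)
    (hx : ∀ c, eval x (chartPoly a s J c) = h c) : Feasible J h := by
  refine ⟨fun g => star fun b => eval x (rxPoly a s J g b),
    fun y b => eval x (txPoly a s J y b), fun g h0 => ?_, fun i => ?_, fun p hp j => ?_⟩
  · have := congrFun (star_eq_zero.1 h0) (a g)
    simp [rxPoly] at this
  · rw [Fintype.linearIndependent_iff]
    intro g hg k
    have := congrFun hg (s i k)
    simpa [txPoly_apply hs] using this
  · rw [star_star, dotProduct_channel_mulVec]
    have h1 := pairing_eq_add_pivot (a := a) (s := s) (J := J) (H := h)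
      (H' := fun c => eval x (chanPoly a s J c))
      (fun c hc => by rw [← hx, chartPoly_of_forall_ne hc])
      (fun r => by rw [chanPoly_pivot, map_zero]) ⟨⟨p, hp⟩, j⟩
      (u := fun b => eval x (rxPoly a s J p.2 b)) (v := fun b => eval x (txPoly a s J ⟨p.1, j⟩ b))
      (by simp [rxPoly])
      (fun k => by rw [txPoly_apply hs]; split_ifs <;> simp)
    rw [h1, ← hx, chartPoly_pivot hs, map_neg, eqPoly, map_pairing]
    exact add_neg_cancel _

/-- Every feasible channel is parametrised by some chart. -/
theorem Feasible.exists_eval_chartPoly {I : Finset (BSUser K)} (hJ : J ⊆ I)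
    {h : Coeff K M N → ℂ} (hh : Feasible I h) :
    ∃ (a : User K → Fin M) (s : ∀ i, Fin (K i) → Fin N), (∀ i, Function.Injective (s i)) ∧
      ∃ x : ChartVar a s J → ℂ, ∀ c, eval x (chartPoly a s J c) = h c := by
  obtain ⟨u, v, hu, hv, huv⟩ := hh
  have hu' : ∀ g, ∃ b, u g b ≠ 0 := fun g => Function.ne_iff.1 (hu g)
  choose a ha using hu'
  choose s hs hdet using fun i => exists_submatrix_det_ne_zero
    (Matrix.of fun j b => v ⟨i, j⟩ b) (hv i)
  refine ⟨a, s, hs, ?_⟩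
  -- Multiplying by the inverse of `B i` recombines the transmit vectors of a cell. This preserves
  -- the nulling because each pair prescribes it for all streams of the cell.
  let B : ∀ i, Matrix (Fin (K i)) (Fin (K i)) ℂ := fun i =>
    (Matrix.of fun j b => v ⟨i, j⟩ b).submatrix id (s i)
  let w : User K → Fin M → ℂ := fun g b => (star (u g (a g)))⁻¹ * star (u g b)
  let v' : User K → Fin N → ℂ := fun y b => ∑ k, (B y.1)⁻¹ y.2 k * v ⟨y.1, k⟩ b
  have hw : ∀ g, w g (a g) = 1 := fun g => inv_mul_cancel₀ (star_ne_zero.2 (ha g))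
  have hv' : ∀ i j k, v' ⟨i, j⟩ (s i k) = if k = j then 1 else 0 := by
    intro i j k
    have := congrFun (congrFun (Matrix.nonsing_inv_mul (B i) (hdet i).isUnit) j) k
    rw [Matrix.mul_apply, Matrix.one_apply] at this
    simp only [eq_comm (a := k)]
    exact this
  have hpair : ∀ r : Row J, pairing h r.1.1 (w r.1.1.2) (v' ⟨r.1.1.1, r.2⟩) = 0 := by
    rintro ⟨⟨p, hp⟩, j⟩
    have h1 : ∀ k, pairing h p (star (u p.2)) (v ⟨p.1, k⟩) = 0 := fun k => by
      rw [← dotProduct_channel_mulVec]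
      exact huv p (hJ hp) k
    have h2 : pairing h p (w p.2) (v' ⟨p.1, j⟩) = ∑ k, (star (u p.2 (a p.2)))⁻¹ *
        (B p.1)⁻¹ j k * pairing h p (star (u p.2)) (v ⟨p.1, k⟩) := by
      simp only [pairing, w, v', Finset.mul_sum]
      rw [Finset.sum_comm]
      refine Finset.sum_congr rfl fun k _ => Finset.sum_congr rfl fun x _ => ?_
      simp only [Pi.star_apply]
      ring
    simp [h2, h1]
  let x : ChartVar a s J → ℂ := Sum.elim (fun c => h c.1)
    (Sum.elim (fun z => w z.1.1 z.1.2) (fun y => v' y.1.1 y.1.2))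
  refine ⟨x, fun c => ?_⟩
  have hchan : ∀ c, (∀ r : Row J, pivot a s r ≠ c) → h c = eval x (chanPoly a s J c) := by
    intro c hc
    simp [chanPoly, hc, x]
  by_cases hc : ∀ r : Row J, pivot a s r ≠ c
  · rw [chartPoly_of_forall_ne hc, hchan c hc]
  · push Not at hc
    obtain ⟨r, rfl⟩ := hc
    have hrx : (fun b => eval x (rxPoly a s J r.1.1.2 b)) = w r.1.1.2 := by
      funext b
      rw [rxPoly]
      split_ifs with h1 h2
      · rw [h1, hw, map_one]
      · simp [x]
      · exact absurd (mem_freeRx.2 ⟨mem_usersOf r, h1⟩) h2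
    have htx : (fun b => eval x (txPoly a s J ⟨r.1.1.1, r.2⟩ b)) = v' ⟨r.1.1.1, r.2⟩ := by
      funext b
      rw [txPoly]
      split_ifs with h1 h2
      · simp [h1, hv']
      · simp [x]
      · rw [mem_freeTx, not_and] at h2
        have := h2 (mem_bsOf r)
        push Not at this
        obtain ⟨k, hk⟩ := this
        replace hk : s r.1.1.1 k = b := hk
        rw [map_zero, ← hk, hv', if_neg fun h => h1 (by rw [← hk, h])]
    have h1 := pairing_eq_add_pivot (a := a) (s := s) (J := J) (H := h)
      (H' := fun c => eval x (chanPoly a s J c)) hchan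
      (fun r => by rw [chanPoly_pivot, map_zero]) r (u := w r.1.1.2) (v := v' ⟨r.1.1.1, r.2⟩)
      (hw _) (fun k => hv' r.1.1.1 r.2 k)
    rw [hpair r] at h1
    rw [chartPoly_pivot hs, map_neg, eqPoly, map_pairing, hrx, htx]
    exact neg_eq_of_add_eq_zero_right h1.symm

/-- The dimension count behind necessity: parameters minus coefficients equals the slack in the
inequality for `J`. -/
theorem card_chartVar (hs : ∀ i, Function.Injective (s i)) :
    (Fintype.card (ChartVar a s J) : ℤ) = Fintype.card (Coeff K M N) - ∑ p ∈ J, (K p.1 : ℤ)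
      + (((usersOf J).card : ℤ) * ((M : ℤ) - 1)
      + ∑ l ∈ bsOf J, ((N : ℤ) - (K l : ℤ)) * (K l : ℤ)) := by
  have h1 : Fintype.card {c : Coeff K M N // ∀ r : Row J, pivot a s r ≠ c} + Fintype.card (Row J)
      = Fintype.card (Coeff K M N) := by
    classical
    have h2 : (Finset.univ.filter fun c : Coeff K M N => ∀ r : Row J, pivot a s r ≠ c) =
        (Finset.univ.image (pivot a s : Row J → Coeff K M N))ᶜ := by
      ext c
      simp only [Finset.mem_filter, Finset.mem_univ, true_and, Finset.mem_compl,
        Finset.mem_image, not_exists]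
    rw [Fintype.card_subtype, h2, ← Finset.card_univ (α := Row J),
      ← Finset.card_image_of_injective _ (pivot_injective a hs J), Finset.card_compl_add_card]
  rw [Fintype.card_sum, Fintype.card_sum, Fintype.card_coe, Fintype.card_coe]
  push_cast
  rw [card_freeRx, card_freeTx s hs, ← h1, card_row]
  push_cast
  ring

end Chart

end CellularIA

/-! ### Dominance of a chart, from the gradients at one point. -/

namespace CellularIA

open MvPolynomial

variable {G M N : ℕ} {K : Fin G → ℕ}
  {a : User K → Fin M} {s : ∀ i, Fin (K i) → Fin N} {J : Finset (BSUser K)}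

/-- The point of a chart with coordinate-vector beamformers and the channel `H`. -/
noncomputable def chartPoint (a : User K → Fin M) (s : ∀ i, Fin (K i) → Fin N)
    (J : Finset (BSUser K)) (H : Coeff K M N → ℂ) : ChartVar a s J → ℂ :=
  Sum.elim (fun c => H c.1) 0

theorem eval_rxPoly (H : Coeff K M N → ℂ) (g : User K) (b : Fin M) :
    eval (chartPoint a s J H) (rxPoly a s J g b) = if b = a g then 1 else 0 := by
  unfold rxPoly
  split_ifs <;> simp [chartPoint]

theorem eval_txPoly (H : Coeff K M N → ℂ) (y : User K) (b : Fin N) :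
    eval (chartPoint a s J H) (txPoly a s J y b) = if b = s y.1 y.2 then 1 else 0 := by
  unfold txPoly
  split_ifs <;> simp [chartPoint]

theorem eval_chanPoly (H : Coeff K M N → ℂ) {c : Coeff K M N}
    (hc : ∀ r : Row J, pivot a s r ≠ c) :
    eval (chartPoint a s J H) (chanPoly a s J c) = H c := by
  simp [chanPoly, hc, chartPoint]

theorem pderiv_inl_rxPoly (c) (g : User K) (b : Fin M) :
    pderiv (Sum.inl c) (rxPoly a s J g b) = 0 := by
  classical
  unfold rxPoly
  split_ifs <;> simp [pderiv_X]

theorem pderiv_inl_txPoly (c) (y : User K) (b : Fin N) :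
    pderiv (Sum.inl c) (txPoly a s J y b) = 0 := by
  classical
  unfold txPoly
  split_ifs <;> simp [pderiv_X]

theorem pderiv_inr_chanPoly (t) (c : Coeff K M N) :
    pderiv (Sum.inr t) (chanPoly a s J c) = 0 := by
  classical
  unfold chanPoly
  split_ifs <;> simp [pderiv_X]

theorem pderiv_rx_rxPoly (x : {x // x ∈ freeRx a (usersOf J)}) (g : User K) (b : Fin M) :
    pderiv (Sum.inr (Sum.inl x)) (rxPoly a s J g b) = if x.1 = (g, b) then 1 else 0 := by
  classical
  have hx := (mem_freeRx.1 x.2).2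
  unfold rxPoly
  split_ifs with h1 h2 h3 h4 h5
  · rw [h2, h1] at hx
    exact absurd rfl hx
  · simp
  · simp [pderiv_X, Pi.single_apply, Subtype.ext_iff, h4]
  · simp [pderiv_X, Subtype.ext_iff, Ne.symm h4]
  · exact absurd (h5 ▸ x.2) h3
  · simp

theorem pderiv_rx_txPoly (x : {x // x ∈ freeRx a (usersOf J)}) (y : User K) (b : Fin N) :
    pderiv (Sum.inr (Sum.inl x)) (txPoly a s J y b) = 0 := by
  classical
  unfold txPoly
  split_ifs <;> simp [pderiv_X]

theorem pderiv_tx_rxPoly (z : {y // y ∈ freeTx s (bsOf J)}) (g : User K) (b : Fin M) :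
    pderiv (Sum.inr (Sum.inr z)) (rxPoly a s J g b) = 0 := by
  classical
  unfold rxPoly
  split_ifs <;> simp [pderiv_X]

theorem pderiv_tx_txPoly (z : {y // y ∈ freeTx s (bsOf J)}) (y : User K) (b : Fin N) :
    pderiv (Sum.inr (Sum.inr z)) (txPoly a s J y b) = if z.1 = (y, b) then 1 else 0 := by
  classical
  have hz := (mem_freeTx.1 z.2).2
  unfold txPoly
  split_ifs with h1 h2 h3 h4 h5
  · rw [h2, h1] at hz
    exact absurd rfl (hz y.2)
  · simp
  · simp [pderiv_X, Pi.single_apply, Subtype.ext_iff, h4]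
  · simp [pderiv_X, Subtype.ext_iff, Ne.symm h4]
  · exact absurd (h5 ▸ z.2) h3
  · simp

/-- The gradient of an equation at a point with coordinate-vector beamformers. -/
theorem eval_pderiv_eqPoly (H : Coeff K M N → ℂ) (r : Row J) (t : ChartVar a s J) :
    eval (chartPoint a s J H) (pderiv t (eqPoly a s J r)) =
      Sum.elim (fun _ => 0) (Sum.elim
        (fun x => if r.1.1.2 = x.1.1 then H (r.1.1, x.1.2, s r.1.1.1 r.2) else 0)
        (fun z => if (⟨r.1.1.1, r.2⟩ : User K) = z.1.1 then H (r.1.1, a r.1.1.2, z.1.2) else 0))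
      t := by
  have hpiv : chanPoly a s J (r.1.1, a r.1.1.2, s r.1.1.1 r.2) = 0 := chanPoly_pivot r
  have hexp : eval (chartPoint a s J H) (pderiv t (eqPoly a s J r)) =
      ∑ x : Fin M × Fin N,
        ((if x.1 = a r.1.1.2 then 1 else 0) *
          eval (chartPoint a s J H) (chanPoly a s J (r.1.1, x.1, x.2)) *
          eval (chartPoint a s J H) (pderiv t (txPoly a s J ⟨r.1.1.1, r.2⟩ x.2)) +
        (if x.1 = a r.1.1.2 then 1 else 0) *
          eval (chartPoint a s J H) (pderiv t (chanPoly a s J (r.1.1, x.1, x.2))) *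
          (if x.2 = s r.1.1.1 r.2 then 1 else 0) +
        eval (chartPoint a s J H) (pderiv t (rxPoly a s J r.1.1.2 x.1)) *
          eval (chartPoint a s J H) (chanPoly a s J (r.1.1, x.1, x.2)) *
          (if x.2 = s r.1.1.1 r.2 then 1 else 0)) := by
    simp only [eqPoly, pairing, map_sum, Derivation.leibniz, smul_eq_mul, map_add, map_mul,
      eval_rxPoly, eval_txPoly]
    exact Finset.sum_congr rfl fun x _ => by ring
  rw [hexp]
  rcases t with c | x | z
  · refine Finset.sum_eq_zero fun x _ => ?_
    rw [pderiv_inl_rxPoly, pderiv_inl_txPoly]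
    by_cases h1 : x.1 = a r.1.1.2 <;> by_cases h2 : x.2 = s r.1.1.1 r.2 <;> simp [h1, h2, hpiv]
  · simp only [pderiv_inr_chanPoly, pderiv_rx_txPoly, pderiv_rx_rxPoly, map_zero, mul_zero,
      zero_mul, zero_add, Sum.elim_inr, Sum.elim_inl]
    split_ifs with h
    · rw [Finset.sum_eq_single (x.1.2, s r.1.1.1 r.2)]
      · have hne : ∀ q : Row J, pivot a s q ≠ (r.1.1, x.1.2, s r.1.1.1 r.2) := by
          intro q hq
          simp only [pivot, Prod.mk.injEq] at hq
          apply (mem_freeRx.1 x.2).2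
          rw [← hq.2.1, hq.1, h]
        simp [h, eval_chanPoly H hne]
      · rintro ⟨b, c⟩ - hbc
        by_cases h1 : x.1 = (r.1.1.2, b)
        · have : c ≠ s r.1.1.1 r.2 := fun h => hbc (by rw [h, h1])
          simp [this]
        · simp [h1]
      · simp
    · refine Finset.sum_eq_zero fun y _ => ?_
      have : x.1 ≠ (r.1.1.2, y.1) := fun h' => h (by rw [h'])
      simp [this]
  · simp only [pderiv_inr_chanPoly, pderiv_tx_txPoly, pderiv_tx_rxPoly, map_zero, mul_zero,
      zero_mul, add_zero, Sum.elim_inr]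
    split_ifs with h
    · rw [Finset.sum_eq_single (a r.1.1.2, z.1.2)]
      · have hne : ∀ q : Row J, pivot a s q ≠ (r.1.1, a r.1.1.2, z.1.2) := by
          rintro ⟨⟨q, hq'⟩, k⟩ hq
          simp only [pivot, Prod.mk.injEq] at hq
          have h3 := (mem_freeTx.1 z.2).2
          rw [← h] at h3
          obtain ⟨rfl, -, h2⟩ := hq
          exact h3 k h2
        simp [h, eval_chanPoly H hne]
      · rintro ⟨b, c⟩ - hbc
        by_cases h1 : z.1 = (⟨r.1.1.1, r.2⟩, c)
        · have : b ≠ a r.1.1.2 := fun h => hbc (by rw [h, h1])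
          simp [this]
        · simp [h1]
      · simp
    · refine Finset.sum_eq_zero fun y _ => ?_
      have : z.1 ≠ (⟨r.1.1.1, r.2⟩, y.2) := fun h' => h (by rw [h'])
      simp [this]

/-- If the linear parts of the equations are independent, the chart is dominant. -/
theorem algebraicIndependent_chartPoly (H : Coeff K M N → ℂ)
    (hH : ∀ g : Row J → ℂ,
      (∀ u b, b ≠ a u →
        ∑ r : Row J, (if r.1.1.2 = u then g r * H (r.1.1, b, s r.1.1.1 r.2) else 0) = 0) →
      (∀ (y : User K) b, (∀ j, s y.1 j ≠ b) →
        ∑ r : Row J, (if (⟨r.1.1.1, r.2⟩ : User K) = y then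
          g r * H (r.1.1, a r.1.1.2, b) else 0) = 0) → g = 0) :
    AlgebraicIndependent ℂ (chartPoly a s J) := by
  classical
  refine algebraicIndependent_of_linearIndependent_pderiv _ (chartPoint a s J H) ?_
  rw [Fintype.linearIndependent_iff]
  intro g hg
  have hD : ∀ t c, eval (chartPoint a s J H) (pderiv t (chartPoly a s J c)) =
      eval (chartPoint a s J H) (pderiv t (chanPoly a s J c)) - ∑ r : Row J,
        if pivot a s r = c then eval (chartPoint a s J H) (pderiv t (eqPoly a s J r)) else 0 := by
    intro t c
    simp only [chartPoly, map_sub, map_sum, apply_ite (pderiv t),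
      apply_ite (eval (chartPoint a s J H)), map_zero]
  -- In a beamformer direction the left side vanishes, leaving a relation among the equation
  -- gradients alone. In a coefficient direction the right side vanishes and the left side is `g c`.
  have hsum : ∀ t, ∑ c, g c * eval (chartPoint a s J H) (pderiv t (chanPoly a s J c)) =
      ∑ r : Row J, g (pivot a s r) *
        eval (chartPoint a s J H) (pderiv t (eqPoly a s J r)) := by
    intro t
    have h := congrFun hg t
    simp only [Finset.sum_apply, Pi.smul_apply, smul_eq_mul, Pi.zero_apply, hD, mul_sub,
      Finset.sum_sub_distrib, Finset.mul_sum, sub_eq_zero] at h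
    rw [h, Finset.sum_comm]
    refine Finset.sum_congr rfl fun r _ => ?_
    rw [Finset.sum_eq_single (pivot a s r)]
    · rw [if_pos rfl]
    · intro c _ hc
      rw [if_neg hc.symm, mul_zero]
    · simp
  have hpiv : (fun r : Row J => g (pivot a s r)) = 0 := by
    apply hH
    · intro u b hb
      by_cases hu : u ∈ usersOf J
      · have := hsum (Sum.inr (Sum.inl ⟨(u, b), mem_freeRx.2 ⟨hu, hb⟩⟩))
        simp only [pderiv_inr_chanPoly, map_zero, mul_zero, Finset.sum_const_zero,
          eval_pderiv_eqPoly, Sum.elim_inr, Sum.elim_inl, mul_ite] at this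
        exact this.symm
      · refine Finset.sum_eq_zero fun r _ => if_neg ?_
        rintro rfl
        exact hu (mem_usersOf r)
    · intro y b hb
      by_cases hy : y.1 ∈ bsOf J
      · have := hsum (Sum.inr (Sum.inr ⟨(y, b), mem_freeTx.2 ⟨hy, hb⟩⟩))
        simp only [pderiv_inr_chanPoly, map_zero, mul_zero, Finset.sum_const_zero,
          eval_pderiv_eqPoly, Sum.elim_inr, mul_ite] at this
        exact this.symm
      · refine Finset.sum_eq_zero fun r _ => if_neg ?_
        rintro rfl
        exact hy (mem_bsOf r)
  intro c
  by_cases hc : ∀ r : Row J, pivot a s r ≠ c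
  · have := hsum (Sum.inl ⟨c, hc⟩)
    simp only [eval_pderiv_eqPoly, Sum.elim_inl, mul_zero, Finset.sum_const_zero] at this
    rw [Finset.sum_eq_single c] at this
    · simpa [chanPoly, hc] using this
    · intro d _ hd
      by_cases h : ∀ r : Row J, pivot a s r ≠ d
      · simp [chanPoly, h, pderiv_X, hd]
      · simp [chanPoly, h]
    · simp
  · push Not at hc
    obtain ⟨r, rfl⟩ := hc
    exact congrFun hpiv r

/-- An assignment of variables to the equations yields a channel with independent linear parts:
the entries are unit vectors on the receive side and powers of distinct nodes on the transmit
side. -/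
theorem algebraicIndependent_chartPoly_of_matching (hs : ∀ i, Function.Injective (s i))
    (m : Row J → (User K × Fin M) ⊕ (User K × Fin N)) (hm : Function.Injective m)
    (hmem : ∀ r, m r ∈ rowVars a s r) : AlgebraicIndependent ℂ (chartPoly a s J) := by
  classical
  let F : ∀ i, Finset (Fin N) := fun i => Finset.univ.filter fun b => ∀ j, s i j ≠ b
  -- `e i` numbers the free columns of cell `i` from 0; its value 0 elsewhere is never used, as only
  -- free columns enter the gradients.
  let e : ∀ i, Fin N → ℕ := fun i b => if h : b ∈ F i then (F i).equivFin ⟨b, h⟩ else 0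
  have he : ∀ i, ∀ k < (F i).card, ∃ b ∈ F i, e i b = k := fun i k hk =>
    ⟨_, ((F i).equivFin.symm ⟨k, hk⟩).2, by simp [e]⟩
  let z : BSUser K → ℂ := fun p => ((Fintype.equivFin (BSUser K) p : ℕ) : ℂ)
  have hz : Function.Injective z := fun p q h =>
    (Fintype.equivFin (BSUser K)).injective (Fin.ext (Nat.cast_injective h))
  -- In row `a` the free columns carry consecutive powers of a node particular to the pair. Any
  -- other row has a 1 only where an equation is matched to that receive coordinate, so that
  -- coordinate isolates its equation.
  let H : Coeff K M N → ℂ := fun c =>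
    if c.2.1 = a c.1.2 then z c.1 ^ e c.1.1 c.2.2
    else if ∃ r : Row J, r.1.1 = c.1 ∧ s r.1.1.1 r.2 = c.2.2 ∧ m r = Sum.inl (c.1.2, c.2.1)
      then 1 else 0
  refine algebraicIndependent_chartPoly H fun g hrx htx => ?_
  have hrow : ∀ q r : Row J, q.1.1 = r.1.1 → s q.1.1.1 q.2 = s r.1.1.1 r.2 → q = r :=
    fun q r h1 h2 => pivot_injective a hs J
      (Prod.ext h1 (Prod.ext (congrArg (fun p : BSUser K => a p.2) h1) h2))
  have hinl : ∀ r x, m r = Sum.inl x → g r = 0 := by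
    intro r x hx
    have h1 := inl_mem_rowVars.1 (hx ▸ hmem r)
    have h2 := hrx x.1 x.2 h1.2
    rw [Finset.sum_eq_single r] at h2
    · rw [if_pos h1.1.symm] at h2
      have : H (r.1.1, x.2, s r.1.1.1 r.2) = 1 := by
        simp only [H]
        rw [if_neg (by rw [← h1.1]; exact h1.2), if_pos ⟨r, rfl, rfl, by rw [hx, ← h1.1]⟩]
      rwa [this, mul_one] at h2
    · intro q _ hq
      split_ifs with h3
      · have : H (q.1.1, x.2, s q.1.1.1 q.2) = 0 := by
          simp only [H]
          rw [if_neg (by rw [h3]; exact h1.2), if_neg]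
          rintro ⟨q', hp, hj, hq'⟩
          rw [h3] at hq'
          obtain rfl : q' = r := hm (hq'.trans hx.symm)
          exact hq (hrow _ _ hp hj).symm
        rw [this, mul_zero]
      · rfl
    · simp
  funext r
  obtain ⟨x, hx⟩ | ⟨w, hw⟩ : (∃ x, m r = Sum.inl x) ∨ ∃ w, m r = Sum.inr w := by
    cases m r <;> simp
  · exact hinl r x hx
  set y : User K := ⟨r.1.1.1, r.2⟩
  -- Once the equations matched to receive coordinates are eliminated, those of stream `y` form a
  -- Vandermonde system. The matching is injective, so there are at most as many of them as free
  -- columns.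
  let S : Finset (Row J) := Finset.univ.filter fun q =>
    (⟨q.1.1.1, q.2⟩ : User K) = y ∧ ∃ w, m q = Sum.inr w
  have hS : ∀ q, q ∈ S ↔ (⟨q.1.1.1, q.2⟩ : User K) = y ∧ ∃ w, m q = Sum.inr w := by
    simp only [S, Finset.mem_filter, Finset.mem_univ, true_and, implies_true]
  have hcard : S.card ≤ (F y.1).card := by
    rw [← Finset.card_image_of_injective S hm]
    refine (Finset.card_le_card (t := (F y.1).image fun b => Sum.inr (y, b)) ?_).trans
      Finset.card_image_le
    intro t ht
    obtain ⟨q, hq, rfl⟩ := Finset.mem_image.1 ht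
    obtain ⟨hqy, ⟨y', b⟩, hq'⟩ := (hS q).1 hq
    have h1 := inr_mem_rowVars.1 (hq' ▸ hmem q)
    rw [hqy] at h1
    obtain ⟨rfl : y' = y, h2⟩ := h1
    rw [hq']
    exact Finset.mem_image.2 ⟨b, by simpa [F] using h2, rfl⟩
  refine eq_zero_of_forall_sum_mul_pow_eq_zero S (fun q => z q.1.1) g ?_ ?_ r
    ((hS r).2 ⟨rfl, w, hw⟩)
  · rintro ⟨⟨p, hp⟩, j⟩ hq ⟨⟨p', hp'⟩, j'⟩ hq' h
    obtain rfl : p = p' := hz h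
    have h1 := ((hS _).1 hq).1.trans ((hS _).1 hq').1.symm
    obtain rfl : j = j' := eq_of_heq (Sigma.mk.inj_iff.1 h1).2
    rfl
  · intro k hk
    obtain ⟨b, hb, hbk⟩ := he y.1 k (hk.trans_le hcard)
    rw [← htx y b (by simpa [F] using hb), Finset.sum_filter]
    refine Finset.sum_congr rfl fun q _ => ?_
    by_cases hqy : (⟨q.1.1.1, q.2⟩ : User K) = y
    · have hH : H (q.1.1, a q.1.1.2, b) = z q.1.1 ^ k := by
        have : q.1.1.1 = y.1 := congrArg Sigma.fst hqy
        simp only [H, if_true]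
        rw [this, hbk]
      rw [if_pos hqy, hH]
      split_ifs with h
      · rfl
      · rcases hmq : m q with x | w
        · rw [hinl q x hmq, zero_mul]
        · exact absurd ⟨hqy, w, hmq⟩ h
    · rw [if_neg hqy, if_neg fun h => hqy h.1]

/-! ### Generic feasibility and infeasibility. -/

theorem generically_of_eval_ne_zero {σ : Type} {P : (σ → ℂ) → Prop} {c : MvPolynomial σ ℂ}
    (hc : c ≠ 0) (h : ∀ x, eval x c ≠ 0 → P x) : Generically P := by
  refine ⟨{x | ∀ p ∈ ({c} : Set (MvPolynomial σ ℂ)), eval x p = 0}ᶜ, ⟨_, rfl⟩, ?_, ?_⟩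
  · by_contra hne
    rw [Set.not_nonempty_iff_eq_empty, Set.compl_empty_iff] at hne
    refine hc (MvPolynomial.funext fun x => ?_)
    have : x ∈ (Set.univ : Set (σ → ℂ)) := trivial
    rw [← hne] at this
    rw [map_zero]
    exact this c rfl
  · intro x hx
    refine h x fun h0 => hx ?_
    rintro p rfl
    exact h0

theorem Generically.of_forall {σ : Type} {P : (σ → ℂ) → Prop} (h : ∀ x, P x) : Generically P :=
  generically_of_eval_ne_zero one_ne_zero fun x _ => h x

/-- Proper subsystems make generic channels feasible. -/
theorem generically_feasible (I : Finset (BSUser K)) (hM : 1 ≤ M) (hN : ∀ g, K g ≤ N)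
    (hI : ∀ J ⊆ I, ((usersOf J).card : ℤ) * ((M : ℤ) - 1)
      + ∑ l ∈ bsOf J, ((N : ℤ) - (K l : ℤ)) * (K l : ℤ) ≥ ∑ p ∈ J, (K p.1 : ℤ)) :
    Generically fun h : Coeff K M N → ℂ => Feasible I h := by
  let a : User K → Fin M := fun _ => ⟨0, hM⟩
  let s : ∀ i, Fin (K i) → Fin N := fun i => Fin.castLE (hN i)
  have hs : ∀ i, Function.Injective (s i) := fun i => Fin.castLE_injective (hN i)
  obtain ⟨m, hm, hmem⟩ := exists_matching a s hs I hI
  obtain ⟨c, hc, h⟩ := exists_forall_mem_image_of_algebraicIndependent _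
    (algebraicIndependent_chartPoly_of_matching hs m hm hmem)
  refine generically_of_eval_ne_zero hc fun y hy => ?_
  obtain ⟨x, hx⟩ := h y hy
  exact feasible_of_eval_chartPoly hs x hx

/-- An improper subsystem makes generic channels infeasible. -/
theorem generically_not_feasible {I J : Finset (BSUser K)} (hJ : J ⊆ I)
    (h : ((usersOf J).card : ℤ) * ((M : ℤ) - 1)
      + ∑ l ∈ bsOf J, ((N : ℤ) - (K l : ℤ)) * (K l : ℤ) < ∑ p ∈ J, (K p.1 : ℤ)) :
    Generically fun h : Coeff K M N → ℂ => ¬ Feasible I h := by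
  classical
  have hrel : ∀ q : (User K → Fin M) × (∀ i, Fin (K i) → Fin N),
      ∃ p : MvPolynomial (Coeff K M N) ℂ, p ≠ 0 ∧
        ((∀ i, Function.Injective (q.2 i)) → aeval (chartPoly q.1 q.2 J) p = 0) := by
    rintro ⟨a, s⟩
    by_cases hs : ∀ i, Function.Injective (s i)
    · obtain ⟨p, hp, hp0⟩ := exists_aeval_eq_zero_of_card_lt (chartPoly a s J) (by
        have := card_chartVar (a := a) (J := J) hs
        omega)
      exact ⟨p, hp, fun _ => hp0⟩
    -- A harmless factor for index choices that are not charts, so that the product below can run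
    -- over all pairs `(a, s)`.
    · exact ⟨1, one_ne_zero, fun h => absurd h hs⟩
  choose p hp hp0 using hrel
  refine generically_of_eval_ne_zero (c := ∏ q, p q) (Finset.prod_ne_zero_iff.2 fun q _ => hp q)
    fun y hy hf => hy ?_
  obtain ⟨a, s, hs, x, hx⟩ := hf.exists_eval_chartPoly hJ
  rw [map_prod]
  refine Finset.prod_eq_zero (Finset.mem_univ (a, s)) ?_
  have h1 := congrArg (eval x) (hp0 (a, s) hs)
  have h2 : y = fun c => eval x (chartPoly a s J c) := funext fun c => (hx c).symm
  rw [h2]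
  have h3 : (eval x).comp (algebraMap ℂ (MvPolynomial (ChartVar a s J) ℂ)) = RingHom.id ℂ := by
    ext
    simp [algebraMap_eq]
  rw [map_zero, map_aeval, h3] at h1
  exact h1

/-- A user must exist for `1 ≤ M`: with no users at all, feasibility is vacuous even for `M = 0`. -/
theorem one_le_of_feasible (hK : ∃ g, 0 < K g) {I : Finset (BSUser K)} {h : Coeff K M N → ℂ}
    (hf : Feasible I h) : 1 ≤ M ∧ ∀ g, K g ≤ N := by
  obtain ⟨u, v, hu, hv, -⟩ := hf
  obtain ⟨g, hg⟩ := hK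
  refine ⟨?_, fun i => ?_⟩
  · obtain ⟨b, -⟩ := Function.ne_iff.1 (hu ⟨g, ⟨0, hg⟩⟩)
    exact b.pos
  · simpa using (hv i).fintype_card_le_finrank

/-- The right-hand condition does not depend on the channel, so it suffices to show generic
feasibility when it holds and generic infeasibility when it fails. -/
theorem generically_feasible_iff (hK : ∃ g, 0 < K g) (I : Finset (BSUser K)) :
    Generically fun h : Coeff K M N → ℂ => (Feasible I h ↔
      1 ≤ M ∧ (∀ g, K g ≤ N) ∧ ∀ J ⊆ I, ((usersOf J).card : ℤ) * ((M : ℤ) - 1)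
        + ∑ l ∈ bsOf J, ((N : ℤ) - (K l : ℤ)) * (K l : ℤ) ≥ ∑ p ∈ J, (K p.1 : ℤ)) := by
  by_cases hMN : 1 ≤ M ∧ ∀ g, K g ≤ N
  · by_cases hI : ∀ J ⊆ I, ((usersOf J).card : ℤ) * ((M : ℤ) - 1)
        + ∑ l ∈ bsOf J, ((N : ℤ) - (K l : ℤ)) * (K l : ℤ) ≥ ∑ p ∈ J, (K p.1 : ℤ)
    · obtain ⟨U, hU, hne, h⟩ := generically_feasible I hMN.1 hMN.2 hI
      exact ⟨U, hU, hne, fun x hx => iff_of_true (h x hx) ⟨hMN.1, hMN.2, hI⟩⟩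
    · have hI' := hI
      push Not at hI'
      obtain ⟨J, hJ, hlt⟩ := hI'
      obtain ⟨U, hU, hne, h⟩ := generically_not_feasible hJ hlt
      exact ⟨U, hU, hne, fun x hx => iff_of_false (h x hx) fun h => hI h.2.2⟩
  · exact Generically.of_forall fun x => iff_of_false
      (fun h => hMN (one_le_of_feasible hK h)) fun h => hMN ⟨h.1, h.2.1⟩

end CellularIA

theorem theorem1 (G M N : ℕ) (K : Fin G → ℕ) (hK : ∃ g, 0 < K g)
    (I : Finset (CellularIA.BSUser K)) (hI : ∀ p ∈ I, p.2.1 ≠ p.1) :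
    (CellularIA.Generically fun h : CellularIA.Coeff K M N → ℂ =>
      (CellularIA.Feasible I h ↔
        1 ≤ M ∧ (∀ g, K g ≤ N) ∧
          ∀ J ⊆ I,
            ((CellularIA.usersOf J).card : ℤ) * ((M : ℤ) - 1)
              + ∑ l ∈ CellularIA.bsOf J, ((N : ℤ) - (K l : ℤ)) * (K l : ℤ)
              ≥ ∑ p ∈ J, (K p.1 : ℤ))) ∧
    (∀ k : ℕ, (∀ g, K g = k) →
      CellularIA.Generically fun h : CellularIA.Coeff K M N → ℂ =>
        (CellularIA.Feasible I h ↔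
          1 ≤ M ∧ k ≤ N ∧
            ∀ J ⊆ I,
              ((CellularIA.usersOf J).card : ℤ) * ((M : ℤ) - 1)
                + ((CellularIA.bsOf J).card : ℤ) * (((N : ℤ) - (k : ℤ)) * (k : ℤ))
                ≥ (J.card : ℤ) * (k : ℤ))) := by
  refine ⟨CellularIA.generically_feasible_iff hK I, fun k hk => ?_⟩
  obtain ⟨U, hU, hne, h⟩ := CellularIA.generically_feasible_iff (M := M) (N := N) hK I
  refine ⟨U, hU, hne, fun x hx => (h x hx).trans ?_⟩
  obtain ⟨g, -⟩ := hK
  -- Needed to reduce `∀ g : Fin G, k ≤ N` to `k ≤ N`.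
  have : Nonempty (Fin G) := ⟨g⟩
  simp only [hk, forall_const, Finset.sum_const, nsmul_eq_mul]
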